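/- Let $s$ be a prime power. Conventions. An $(n,m,s^p)$ design is an $n\times m$ array $D=(x_{ak})$ with entries in $\{0,\dots,s^p-1\}$; it is balanced (U-type) if in each column all $s^p$ levels appear equally often. It is a $\mathrm{GSOA}(n,m,s^p,t)$ if, for every $1\le g\le t$, any $g$ columns and any positive integers $u_1,\dots,u_g\le p$ with $u_1+\dots+u_g=t$, all $s^{u_1}\cdots s^{u_g}$ level combinations appear equally often among the rows of these $g$ columns after the $i$-th of them is collapsed by $x\mapsto\lfloor x/s^{p-u_i}\rfloor$. A generalized Hadamard matrix $\mathrm{GH}(n,r)$ is an $n\times n$ array over the finite field $\mathrm{GF}(r)$ such that, for any two distinct columns, each element of $\mathrm{GF}(r)$ appears exactly $n/r$ times in their componentwise difference. For a weight function $\omega:\{0,\dots,p\}\to[0,\infty)$ put $z_{ak}=(2x_{ak}+1)/(2s^p)$, let $\delta_i(x,y)=1$ if $\lfloor s^ix\rfloor=\lfloor s^iy\rfloor$ and $0$ otherwise, and $$d_{ab}=\sum_{k=1}^m\sum_{i=0}^p\frac{\omega(i)}{s^i}\bigl(1-\delta_i(z_{ak},z_{bk})\bigr),\qquad G_D=\sum_{a,b=1}^n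 d_{ab}^2 .$$ For an $(n,m,s^p)$ design $D$ with rows $z_a=(z_{a1},\dots,z_{am})$ let $$\mathrm{SD}^2(D)=\sum_{u\in\{0,\dots,p\}^m}\Bigl(\prod_{k=1}^m\omega(u_k)\Bigr)\int_{[0,1)^m}\Bigl|\mathrm{Vol}(R_u(x))-\frac{|\{a: z_a\in R_u(x)\}|}{n}\Bigr|^2dx,$$ where $R_u(x)=\prod_{k=1}^m\bigl[s^{-u_k}\lfloor s^{u_k}x_k\rfloor,\ s^{-u_k}\lfloor s^{u_k}x_k\rfloor+s^{-u_k}\bigr)$, and for $m\ge2$ let $\Phi_{\rm SD}(D)=\frac{2}{m(m-1)}\sum_{|v|=2}\mathrm{SD}^2(D_v)$ be the average over all subdesigns $D_v$ formed by two columns of $D$. With $A_0=\sum_i\omega(i)s^{-i}$, $A_1=\sum_i\omega(i)s^{-2i}$, $B=\sum_i\omega(i)^2s^{-3i}$ and $C=\sum_{i<j}\omega(i)\omega(j)s^{-i-2j}$, the lower bounds for balanced $(n,m,s^p)$ designs are $$G_D^{\rm LB}=\frac{n^3m^2}{n-1}(A_0-A_1)^2,$$ $$\Phi_{\rm SD}^{\rm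 LB}=\frac{mA_0^2-2mA_0A_1+(n+m-1)A_1^2}{(n-1)(m-1)}-\frac{B+2C}{m-1}.$$ A design $D$ is said to attain the lower bounds if, for every such $\omega$, $G_D=G_D^{\rm LB}$ and (when $m\ge2$) $\Phi_{\rm SD}(D)=\Phi_{\rm SD}^{\rm LB}$. Proposition. (i) Let $\lambda\ge1$ and $1\le q\le p$ be integers and suppose that a generalized Hadamard matrix $\mathrm{GH}(\lambda s^p,s^p)$ exists. Then there exists a balanced $\mathrm{GSOA}(\lambda s^p,\lambda s^p-1,s^q,t)$ that attains the lower bounds (for $s^q$ levels), where $t=2$ if $s=2$ and $t=1$ if $s>2$. (ii) There exists a balanced $\mathrm{GSOA}(s^2,s+1,s^2,2)$ that attains the lower bounds. -/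

import Mathlib

open MeasureTheory
open scoped BigOperators

noncomputable section

/-- An `(n, m, s ^ p)` design: `n` runs (rows), factors (columns) indexed by `κ` (`κ = Fin m` for
`m` factors), and levels `0, …, s ^ p - 1`. -/
abbrev Design (n : ℕ) (κ : Type*) (s p : ℕ) : Type _ := Matrix (Fin n) κ (Fin (s ^ p))

/-- U-type (balanced): in every column each of the `s ^ p` levels appears equally often. -/
def IsUType {n s p : ℕ} {κ : Type*} (D : Design n κ s p) : Prop :=
  ∀ k : κ, ∀ v w : Fin (s ^ p), {a | D a k = v}.ncard = {a | D a k = w}.ncard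

/-- The array `A`, whose column `k` has the levels `0, …, L k - 1`, is an orthogonal array of
strength `t`: in any `t` columns all level combinations appear equally often. -/
def IsOA {n : ℕ} {κ : Type*} {L : κ → ℕ} (A : Fin n → (k : κ) → Fin (L k)) (t : ℕ) : Prop :=
  ∀ T : Finset κ, T.card = t → ∀ c c' : (k : T) → Fin (L k),
    {a | ∀ k : T, A a k = c k}.ncard = {a | ∀ k : T, A a k = c' k}.ncard

/-- The collapsing map `x ↦ ⌊x / s ^ (p - u)⌋` from `s ^ p` levels to `s ^ u` levels. -/
def collapse {s p u : ℕ} (h : u ≤ p) (x : Fin (s ^ p)) : Fin (s ^ u) :=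
  ⟨x / s ^ (p - u), Nat.div_lt_of_lt_mul (by
    rw [← pow_add, Nat.sub_add_cancel h]
    exact x.isLt)⟩

/-- `D` is a general strong orthogonal array `GSOA(n, m, s ^ p, t)`: any `g` columns
(`1 ≤ g ≤ t`, the column set `S` below) can be collapsed into an
`OA(n, g, s ^ u₁ × ⋯ × s ^ u_g, g)` whenever `u₁ + ⋯ + u_g = t` and `1 ≤ u_i ≤ p`. -/
def IsGSOA {n m s p : ℕ} (D : Design n (Fin m) s p) (t : ℕ) : Prop :=
  ∀ S : Finset (Fin m), 1 ≤ S.card → S.card ≤ t →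
    ∀ u : S → ℕ, (∀ k, 1 ≤ u k) → ∀ hu : ∀ k, u k ≤ p, ∑ k, u k = t →
      IsOA (L := fun k : S => s ^ u k) (fun a k => collapse (hu k) (D a k)) S.card

/-- An `n × n` array over the finite field `F` is a generalized Hadamard matrix `GH(n, |F|)` if,
for every pair of distinct columns, each element of `F` appears exactly `n / |F|` times in the
componentwise difference of these columns. -/
def IsGeneralizedHadamard {n : ℕ} {F : Type*} [Field F] [Fintype F]
    (H : Matrix (Fin n) (Fin n) F) : Prop :=
  ∀ j k : Fin n, j ≠ k → ∀ g : F,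
    ({i | H i j - H i k = g}.ncard : ℚ) = (n : ℚ) / (Fintype.card F : ℚ)

/-- The embedding `z_{ak} = (2 x_{ak} + 1) / (2 s ^ p)` of a design into the unit cube. -/
def embedPt {n s p : ℕ} {κ : Type*} (D : Design n κ s p) (a : Fin n) (k : κ) : ℝ :=
  (2 * ((D a k : ℕ) : ℝ) + 1) / (2 * (s : ℝ) ^ p)

/-- The stratified interval `R_u(x)`: the one of the `s ^ u` equal subintervals of `[0, 1)` that
contains `x`. -/
def stratInterval (s u : ℕ) (x : ℝ) : Set ℝ :=
  Set.Ico ((⌊(s : ℝ) ^ u * x⌋ : ℝ) / (s : ℝ) ^ u)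
    ((⌊(s : ℝ) ^ u * x⌋ : ℝ) / (s : ℝ) ^ u + 1 / (s : ℝ) ^ u)

/-- The stratified region `R_u(x) = R_{u₁}(x₁) × ⋯ × R_{u_m}(x_m)`. -/
def stratRegion {κ : Type*} {p : ℕ} (s : ℕ) (u : κ → Fin (p + 1)) (x : κ → ℝ) : Set (κ → ℝ) :=
  Set.univ.pi fun k => stratInterval s (u k) (x k)

/-- The local projection discrepancy `Vol(R_u(x)) - |P ∩ R_u(x)| / n` of the point set `P` of the
design (points counted with multiplicity). -/
def localDisc {n s p : ℕ} {κ : Type*} [Fintype κ] (D : Design n κ s p) (u : κ → Fin (p + 1))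
    (x : κ → ℝ) : ℝ :=
  volume.real (stratRegion s u x) - ({a | embedPt D a ∈ stratRegion s u x}.ncard : ℝ) / (n : ℝ)

/-- The squared stratified `L₂`-discrepancy `∑_u ω(u) ∫_{[0,1)^m} |disc_u(x; P)|² dx`, with the
product weight `ω(u) = ∏_k ω(u_k)`. -/
def sqSD {n s p : ℕ} {κ : Type*} [Fintype κ] [DecidableEq κ] (ω : Fin (p + 1) → ℝ)
    (D : Design n κ s p) : ℝ :=
  ∑ u : κ → Fin (p + 1), (∏ k, ω (u k)) *
    ∫ x in Set.univ.pi fun _ : κ => Set.Ico (0 : ℝ) 1, |localDisc D u x| ^ 2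

/-- `Φ_SD(D)`: the average of the squared stratified `L₂`-discrepancy over all two-column
subdesigns (meaningful for `m ≥ 2`). -/
def PhiSD {n m s p : ℕ} (ω : Fin (p + 1) → ℝ) (D : Design n (Fin m) s p) : ℝ :=
  2 / ((m : ℝ) * ((m : ℝ) - 1)) *
    ∑ u ∈ (Finset.univ : Finset (Fin m)).powersetCard 2,
      sqSD ω (D.submatrix id (fun k : u => (k : Fin m)) : Design n u s p)

/-- `δ_i(x, y)`: it is `1` if `⌊s ^ i x⌋ = ⌊s ^ i y⌋` and `0` otherwise. -/
def deltaRes (s i : ℕ) (x y : ℝ) : ℝ :=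
  if ⌊(s : ℝ) ^ i * x⌋ = ⌊(s : ℝ) ^ i * y⌋ then 1 else 0

/-- The weighted hierarchical distance `d_{ab}` between the runs `a` and `b`. -/
def hierDist {n m s p : ℕ} (ω : Fin (p + 1) → ℝ) (D : Design n (Fin m) s p) (a b : Fin n) : ℝ :=
  ∑ k : Fin m, ∑ i : Fin (p + 1),
    ω i / (s : ℝ) ^ (i : ℕ) * (1 - deltaRes s i (embedPt D a k) (embedPt D b k))

/-- `G_D = ∑_a ∑_b d_{ab}²`. -/
def GD {n m s p : ℕ} (ω : Fin (p + 1) → ℝ) (D : Design n (Fin m) s p) : ℝ :=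
  ∑ a, ∑ b, hierDist ω D a b ^ 2

/-- `A₀ = ∑_i ω(i) / s ^ i`. -/
def constA0 {p : ℕ} (s : ℕ) (ω : Fin (p + 1) → ℝ) : ℝ :=
  ∑ i : Fin (p + 1), ω i / (s : ℝ) ^ (i : ℕ)

/-- `A₁ = ∑_i ω(i) / s ^ (2 i)`. -/
def constA1 {p : ℕ} (s : ℕ) (ω : Fin (p + 1) → ℝ) : ℝ :=
  ∑ i : Fin (p + 1), ω i / (s : ℝ) ^ (2 * (i : ℕ))

/-- `B = ∑_i ω(i)² / s ^ (3 i)`. -/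
def constB {p : ℕ} (s : ℕ) (ω : Fin (p + 1) → ℝ) : ℝ :=
  ∑ i : Fin (p + 1), ω i ^ 2 / (s : ℝ) ^ (3 * (i : ℕ))

/-- `C = ∑_{i < j} ω(i) ω(j) / s ^ (i + 2 j)`. -/
def constC {p : ℕ} (s : ℕ) (ω : Fin (p + 1) → ℝ) : ℝ :=
  ∑ i : Fin (p + 1), ∑ j ∈ Finset.Ioi i, ω i * ω j / (s : ℝ) ^ ((i : ℕ) + 2 * (j : ℕ))

/-- The lower bound `G_D^LB` for U-type `(n, m, s ^ p)` designs. -/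
def GDLB {p : ℕ} (n m s : ℕ) (ω : Fin (p + 1) → ℝ) : ℝ :=
  (n : ℝ) ^ 3 * (m : ℝ) ^ 2 / ((n : ℝ) - 1) * (constA0 s ω - constA1 s ω) ^ 2

/-- The lower bound `Φ_SD^LB` for U-type `(n, m, s ^ p)` designs. -/
def PhiSDLB {p : ℕ} (n m s : ℕ) (ω : Fin (p + 1) → ℝ) : ℝ :=
  (m : ℝ) / (((n : ℝ) - 1) * ((m : ℝ) - 1)) * constA0 s ω ^ 2
    - 2 * (m : ℝ) / (((n : ℝ) - 1) * ((m : ℝ) - 1)) * constA0 s ω * constA1 s ω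
    + ((n : ℝ) + (m : ℝ) - 1) / (((n : ℝ) - 1) * ((m : ℝ) - 1)) * constA1 s ω ^ 2
    - 1 / ((m : ℝ) - 1) * constB s ω
    - 2 / ((m : ℝ) - 1) * constC s ω

/-- `D` attains the lower bounds `G_D^LB` and `Φ_SD^LB`, for every nonnegative weight function
(`Φ_SD` and its bound are only defined for at least two factors). -/
def AttainsLowerBounds {n m s p : ℕ} (D : Design n (Fin m) s p) : Prop :=
  ∀ ω : Fin (p + 1) → ℝ, (∀ i, 0 ≤ ω i) →
    GD ω D = GDLB n m s ω ∧ (2 ≤ m → PhiSD ω D = PhiSDLB n m s ω)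

end

/-! For a balanced design the total of the distances `d_{ab}` is fixed, and the diagonal distances
vanish. If all distances between distinct runs coincide, their common value is therefore forced, and
`G_D` equals `G_D^LB`, the value Cauchy–Schwarz gives over the `n(n-1)` off-diagonal pairs.
Integrating the squared local discrepancy expresses `Φ_SD` through products of coincidences over
pairs of columns. For balanced designs this makes `Φ_SD` an affine function of `G_D`
(`IsUType.phiSD_eq`), so both bounds are attained together. To cover all weights at once, it
suffices that at every resolution `i` the number of columns in which two distinct runs share their
first `i` base-`s` digits is independent of the pair (`IsUType.attainsLowerBounds`).

For (i), subtract one column of the generalized Hadamard matrix from the others, drop it, and read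
field elements as digit strings through an additive isomorphism `F ≃+ (Fin p → G)` with `|G| = s`;
only the first `q` digits are kept. Balance comes from column differences. Equidistance comes from
row differences, which are also uniform (`card_filter_sub_transpose`, by characters). For `s = 2`,
uniform margins and a balanced diagonal make every pair of leading digits uniform, giving strength
2.

For (ii), the runs are the points of the affine plane over `G` and the columns its `s + 1` parallel
classes. The first digit names the line through the point and the second its position on that line.
Two distinct points share exactly one line. -/

/-! ### Strata: digits, membership and volume -/

theorem floor_mul_level {s p i x : ℕ} (hs : 0 < s) (hi : i ≤ p) :
    ⌊(s : ℝ) ^ i * ((2 * (x : ℝ) + 1) / (2 * (s : ℝ) ^ p))⌋ = ((x / s ^ (p - i) : ℕ) : ℤ) := by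
  have hP : 0 < s ^ (p - i) := pow_pos hs _
  have hsp : (s : ℝ) ^ p = (s : ℝ) ^ i * ((s ^ (p - i) : ℕ) : ℝ) := by
    push_cast
    rw [← pow_add, Nat.add_sub_cancel' hi]
  have hsi : (0 : ℝ) < (s : ℝ) ^ i := pow_pos (by exact_mod_cast hs) _
  set P := s ^ (p - i)
  have hP' : (0 : ℝ) < (P : ℝ) := by exact_mod_cast hP
  have h1 : (P : ℝ) * ((x / P : ℕ) : ℝ) ≤ x := by exact_mod_cast Nat.mul_div_le x P
  have h2 : (x : ℝ) + 1 ≤ (P : ℝ) * (((x / P : ℕ) : ℝ) + 1) := by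
    exact_mod_cast Nat.succ_le_of_lt (Nat.lt_mul_div_succ x hP)
  have he : (s : ℝ) ^ i * ((2 * (x : ℝ) + 1) / (2 * (s : ℝ) ^ p)) = (2 * x + 1) / (2 * P) := by
    rw [hsp]
    field_simp
  rw [he, Int.floor_eq_iff, le_div_iff₀ (by positivity), div_lt_iff₀ (by positivity)]
  rw [Int.cast_natCast]
  constructor <;> nlinarith

theorem deltaRes_embedPt {n s p i : ℕ} {κ : Type*} (hs : 0 < s) (hi : i ≤ p) (D : Design n κ s p)
    (a b : Fin n) (k : κ) :
    deltaRes s i (embedPt D a k) (embedPt D b k) =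
      if (D a k : ℕ) / s ^ (p - i) = (D b k : ℕ) / s ^ (p - i) then 1 else 0 := by
  unfold deltaRes embedPt
  rw [floor_mul_level hs hi, floor_mul_level hs hi]
  simp only [Nat.cast_inj]

theorem mem_stratInterval {s u : ℕ} (hs : 0 < s) {x z : ℝ} :
    z ∈ stratInterval s u x ↔ ⌊(s : ℝ) ^ u * z⌋ = ⌊(s : ℝ) ^ u * x⌋ := by
  have h : (0 : ℝ) < (s : ℝ) ^ u := pow_pos (by exact_mod_cast hs) _
  unfold stratInterval
  rw [Set.mem_Ico, ← add_div, div_le_iff₀ h, lt_div_iff₀ h, Int.floor_eq_iff, mul_comm z]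

theorem stratInterval_subset {s u : ℕ} (hs : 0 < s) {x : ℝ} (hx : x ∈ Set.Ico (0 : ℝ) 1) :
    stratInterval s u x ⊆ Set.Ico 0 1 := by
  have h : (0 : ℝ) < (s : ℝ) ^ u := pow_pos (by exact_mod_cast hs) _
  have h0 : 0 ≤ ⌊(s : ℝ) ^ u * x⌋ := Int.floor_nonneg.2 (mul_nonneg h.le hx.1)
  have h1 : ⌊(s : ℝ) ^ u * x⌋ + 1 ≤ ((s ^ u : ℕ) : ℤ) := by
    rw [Int.add_one_le_iff, Int.floor_lt]
    push_cast
    nlinarith [hx.2]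
  have h1' : (⌊(s : ℝ) ^ u * x⌋ : ℝ) + 1 ≤ (s : ℝ) ^ u := by exact_mod_cast h1
  have h0' : (0 : ℝ) ≤ (⌊(s : ℝ) ^ u * x⌋ : ℝ) := by exact_mod_cast h0
  unfold stratInterval
  apply Set.Ico_subset_Ico
  · positivity
  · rw [← add_div, div_le_one h]
    exact h1'

theorem volume_stratInterval {s u : ℕ} (x : ℝ) :
    volume (stratInterval s u x) = ENNReal.ofReal (1 / (s : ℝ) ^ u) := by
  unfold stratInterval
  rw [Real.volume_Ico, add_sub_cancel_left]

theorem volume_real_stratRegion {κ : Type*} [Fintype κ] {s p : ℕ} (u : κ → Fin (p + 1))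
    (x : κ → ℝ) :
    volume.real (stratRegion s u x) = ∏ k, 1 / (s : ℝ) ^ (u k : ℕ) := by
  unfold stratRegion
  rw [measureReal_def, volume_pi_pi, ENNReal.toReal_prod]
  refine Finset.prod_congr rfl fun k _ => ?_
  rw [volume_stratInterval, ENNReal.toReal_ofReal (by positivity)]

theorem embedPt_mem_Ico {n s p : ℕ} {κ : Type*} (hs : 0 < s) (D : Design n κ s p) (a : Fin n)
    (k : κ) : embedPt D a k ∈ Set.Ico (0 : ℝ) 1 := by
  have h : (0 : ℝ) < (s : ℝ) ^ p := pow_pos (by exact_mod_cast hs) _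
  have h1 : ((D a k : ℕ) : ℝ) + 1 ≤ (s : ℝ) ^ p := by exact_mod_cast (D a k).isLt
  unfold embedPt
  constructor
  · positivity
  · rw [div_lt_one (by positivity)]
    linarith

/-- Strata are the classes of an equivalence relation. The symmetry replaces the moving region
around `x` by a fixed region around a design point, whose indicator can be integrated. -/
theorem mem_stratRegion_comm {κ : Type*} {s p : ℕ} (hs : 0 < s) (u : κ → Fin (p + 1))
    (x z : κ → ℝ) : z ∈ stratRegion s u x ↔ x ∈ stratRegion s u z := by
  simp only [stratRegion, Set.mem_univ_pi, mem_stratInterval hs]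
  exact forall_congr' fun k => eq_comm

theorem measurableSet_stratRegion {κ : Type*} [Fintype κ] {s p : ℕ} (u : κ → Fin (p + 1))
    (x : κ → ℝ) : MeasurableSet (stratRegion s u x) :=
  MeasurableSet.univ_pi fun _ => measurableSet_Ico

/-! ### Closed form of the stratified discrepancy -/

theorem localDisc_sq {n s p : ℕ} {κ : Type*} [Fintype κ] (hs : 0 < s) (D : Design n κ s p)
    (u : κ → Fin (p + 1)) (x : κ → ℝ) :
    |localDisc D u x| ^ 2 =
      (∏ k, 1 / (s : ℝ) ^ (u k : ℕ)) ^ 2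
      - (∑ a, 2 * (∏ k, 1 / (s : ℝ) ^ (u k : ℕ)) / n *
          (stratRegion s u (embedPt D a)).indicator 1 x)
      + ∑ a, ∑ b, (∏ k, deltaRes s (u k) (embedPt D a k) (embedPt D b k)) / (n : ℝ) ^ 2 *
          (stratRegion s u (embedPt D a)).indicator 1 x := by
  classical
  have hN : ({a | embedPt D a ∈ stratRegion s u x}.ncard : ℝ) =
      ∑ a, (stratRegion s u (embedPt D a)).indicator (1 : (κ → ℝ) → ℝ) x := by
    rw [Set.ncard_eq_toFinset_card', Set.toFinset_ofPred]
    simp only [Set.indicator_apply, mem_stratRegion_comm hs u x, Pi.one_apply,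
      Finset.sum_boole]
  -- Two cells of the same stratification are equal or disjoint.
  have hprod : ∀ a b, (stratRegion s u (embedPt D a)).indicator (1 : (κ → ℝ) → ℝ) x *
      (stratRegion s u (embedPt D b)).indicator (1 : (κ → ℝ) → ℝ) x =
      (∏ k, deltaRes s (u k) (embedPt D a k) (embedPt D b k)) *
        (stratRegion s u (embedPt D a)).indicator (1 : (κ → ℝ) → ℝ) x := by
    intro a b
    by_cases ha : x ∈ stratRegion s u (embedPt D a)
    · have ha' := ha
      simp only [stratRegion, Set.mem_univ_pi, mem_stratInterval hs] at ha'
      simp only [Set.indicator_apply, ha, if_true, Pi.one_apply, one_mul, mul_one, deltaRes,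
        Finset.prod_boole, Finset.mem_univ, true_imp_iff]
      refine if_congr ?_ rfl rfl
      simp only [stratRegion, Set.mem_univ_pi, mem_stratInterval hs, ha']
    · simp [Set.indicator_apply, ha]
  rw [sq_abs, localDisc, volume_real_stratRegion, hN]
  have : ∀ V S : ℝ, (V - S / n) ^ 2 = V ^ 2 - 2 * V / n * S + S * S / (n : ℝ) ^ 2 := by
    intro V S
    rw [sub_sq, div_pow]
    ring
  rw [this, ← Finset.mul_sum, Finset.sum_mul_sum]
  simp only [hprod, Finset.sum_div, div_mul_eq_mul_div]

/-- With `V` the volume of a cell, the cross term integrates to `-2V²`, since every design point's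
cell lies inside the cube. Together with the constant `V²` it leaves `-V²`. -/
theorem integral_localDisc_sq {n s p : ℕ} {κ : Type*} [Fintype κ] (hs : 0 < s) (hn : 0 < n)
    (D : Design n κ s p) (u : κ → Fin (p + 1)) :
    (∫ x in Set.univ.pi fun _ : κ => Set.Ico (0 : ℝ) 1, |localDisc D u x| ^ 2) =
      - (∏ k, 1 / (s : ℝ) ^ (u k : ℕ)) ^ 2
      + (∏ k, 1 / (s : ℝ) ^ (u k : ℕ)) *
        (∑ a, ∑ b, ∏ k, deltaRes s (u k) (embedPt D a k) (embedPt D b k)) / (n : ℝ) ^ 2 := by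
  set Q : Set (κ → ℝ) := Set.univ.pi fun _ : κ => Set.Ico (0 : ℝ) 1 with hQ
  have hvol : volume Q = 1 := by
    rw [hQ, volume_pi_pi]
    simp
  have hfin : IsFiniteMeasure (volume.restrict Q) := ⟨by simp [hvol]⟩
  have hind : ∀ a, ∫ x in Q, (stratRegion s u (embedPt D a)).indicator (1 : (κ → ℝ) → ℝ) x =
      ∏ k, 1 / (s : ℝ) ^ (u k : ℕ) := by
    intro a
    rw [integral_indicator_one (measurableSet_stratRegion _ _), measureReal_restrict_apply
      (measurableSet_stratRegion _ _), Set.inter_eq_left.2, volume_real_stratRegion]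
    exact Set.pi_mono fun k _ => stratInterval_subset hs (embedPt_mem_Ico hs D a k)
  have hint : ∀ (a) (c : ℝ), Integrable (fun x => c *
      (stratRegion s u (embedPt D a)).indicator (1 : (κ → ℝ) → ℝ) x) (volume.restrict Q) :=
    fun a c => ((integrable_const (1 : ℝ)).indicator (measurableSet_stratRegion _ _)).const_mul c
  simp only [localDisc_sq hs]
  have hsub : Integrable (fun x => (∏ k, 1 / (s : ℝ) ^ (u k : ℕ)) ^ 2
      - ∑ a, 2 * (∏ k, 1 / (s : ℝ) ^ (u k : ℕ)) / n *
          (stratRegion s u (embedPt D a)).indicator (1 : (κ → ℝ) → ℝ) x) (volume.restrict Q) :=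
    (integrable_const _).sub (integrable_finsetSum _ fun a _ => hint a _)
  rw [integral_add hsub (integrable_finsetSum _ fun a _ => integrable_finsetSum _ fun b _ => hint a _),
    integral_sub (integrable_const _) (integrable_finsetSum _ fun a _ => hint a _),
    integral_finsetSum _ (fun a _ => hint a _),
    integral_finsetSum _ (fun a _ => integrable_finsetSum _ fun b _ => hint a _)]
  simp only [integral_const_mul, hind, integral_const, measureReal_def,
    Measure.restrict_apply_univ, hvol, Finset.sum_const, Finset.card_univ, Fintype.card_fin,
    ← Finset.sum_mul, ← Finset.sum_div]
  have : (n : ℝ) ≠ 0 := by exact_mod_cast hn.ne'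
  simp only [nsmul_eq_mul, smul_eq_mul, ENNReal.toReal_one]
  field_simp
  ring

/-- The weighted coincidence of the runs `a` and `b` in the factor `k`. -/
noncomputable def coincidence {n s p : ℕ} {κ : Type*} (ω : Fin (p + 1) → ℝ) (D : Design n κ s p)
    (a b : Fin n) (k : κ) : ℝ :=
  ∑ i : Fin (p + 1), ω i / (s : ℝ) ^ (i : ℕ) * deltaRes s i (embedPt D a k) (embedPt D b k)

/-- The weights are products, so by distributivity the sum over all `u` factors into one sum per
column. -/
theorem sqSD_eq {n s p : ℕ} {κ : Type*} [Fintype κ] [DecidableEq κ] (hs : 0 < s) (hn : 0 < n)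
    (ω : Fin (p + 1) → ℝ) (D : Design n κ s p) :
    sqSD ω D = - constA1 s ω ^ Fintype.card κ +
      (∑ a, ∑ b, ∏ k, coincidence ω D a b k) / (n : ℝ) ^ 2 := by
  unfold sqSD coincidence
  simp only [integral_localDisc_sq hs hn, mul_add, Finset.sum_add_distrib]
  congr 1
  · rw [constA1, ← Finset.card_univ, ← Finset.prod_const, Finset.prod_univ_sum,
      Fintype.piFinset_univ, ← Finset.sum_neg_distrib]
    refine Finset.sum_congr rfl fun u _ => ?_
    rw [mul_neg, ← Finset.prod_pow, ← Finset.prod_mul_distrib]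
    congr 1
    refine Finset.prod_congr rfl fun k _ => ?_
    rw [div_pow, one_pow, ← pow_mul, mul_comm 2, mul_one_div]
  · simp only [Finset.prod_univ_sum, Fintype.piFinset_univ, Finset.prod_mul_distrib,
      Finset.prod_div_distrib]
    have hx : ∀ a : Fin n, (∑ b, ∑ u : κ → Fin (p + 1), (∏ k, ω (u k)) /
        (∏ k, (s : ℝ) ^ (u k : ℕ)) * ∏ k, deltaRes s (u k) (embedPt D a k) (embedPt D b k)) =
        ∑ u : κ → Fin (p + 1), ∑ b, (∏ k, ω (u k)) /
        (∏ k, (s : ℝ) ^ (u k : ℕ)) * ∏ k, deltaRes s (u k) (embedPt D a k) (embedPt D b k) :=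
      fun a => Finset.sum_comm
    simp only [hx]
    rw [Finset.sum_comm, Finset.sum_div]
    refine Finset.sum_congr rfl fun u _ => ?_
    simp only [← Finset.mul_sum, Finset.prod_const_one]
    ring

/-- Used to trade the sum over two-column subdesigns for squares of row-pair coincidences, which are
what `G_D` sees. -/
theorem sq_sum_eq_add_sum_powersetCard_two {ι : Type*} [DecidableEq ι] (f : ι → ℝ)
    (S : Finset ι) :
    (∑ k ∈ S, f k) ^ 2 = ∑ k ∈ S, f k ^ 2 + 2 * ∑ v ∈ S.powersetCard 2, ∏ k ∈ v, f k := by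
  induction S using Finset.induction_on with
  | empty => simp [Finset.powersetCard_eq_empty.2 (show (∅ : Finset ι).card < 2 by simp)]
  | insert a S ha ih =>
    have hdisj : Disjoint (S.powersetCard 2) ((S.powersetCard 1).image (insert a)) := by
      rw [Finset.disjoint_left]
      intro v hv hv'
      obtain ⟨w, _, rfl⟩ := Finset.mem_image.1 hv'
      exact ha ((Finset.mem_powersetCard.1 hv).1 (Finset.mem_insert_self a w))
    have hone : ∑ v ∈ (S.powersetCard 1).image (insert a), ∏ k ∈ v, f k = f a * ∑ k ∈ S, f k := by
      rw [Finset.powersetCard_one, Finset.sum_image, Finset.sum_map, Finset.mul_sum]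
      · refine Finset.sum_congr rfl fun k hk => ?_
        have : a ≠ k := fun h => ha (h ▸ hk)
        simp [Finset.prod_pair this]
      · intro v hv w hw h
        simp only [Finset.coe_map, Set.mem_image, Finset.mem_coe] at hv hw
        obtain ⟨x, hx, rfl⟩ := hv
        obtain ⟨y, hy, rfl⟩ := hw
        have hax : x ≠ a := fun h => ha (h ▸ hx)
        have : x ∈ insert a ({y} : Finset ι) := by
          rw [← show _ = insert a ({y} : Finset ι) from h]
          simp
        simp only [Finset.mem_insert, hax, Finset.mem_singleton, false_or] at this
        simp [this]
    rw [Finset.sum_insert ha, Finset.sum_insert ha, Finset.powersetCard_succ_insert ha,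
      Finset.sum_union hdisj, hone, add_sq, ih]
    ring

/-! ### Moments of coincidences in balanced designs -/

theorem card_level_filter_div {s p u v : ℕ} (hu : u ≤ p) (hv : v < s ^ u) :
    (Finset.univ.filter fun x : Fin (s ^ p) => (x : ℕ) / s ^ (p - u) = v).card = s ^ (p - u) := by
  have hsp : s ^ p = s ^ u * s ^ (p - u) := by rw [← pow_add, Nat.add_sub_cancel' hu]
  -- Degenerate case: a zero block length forces `s ^ p = 0`, so there are no levels at all.
  rcases Nat.eq_zero_or_pos (s ^ (p - u)) with h0 | hP
  · rw [h0, mul_zero] at hsp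
    rw [h0, Finset.card_eq_zero, Finset.filter_eq_empty_iff]
    intro x
    exact absurd x.isLt (by omega)
  have hcard := Finset.card_map (s := Finset.univ.filter
    fun x : Fin (s ^ p) => (x : ℕ) / s ^ (p - u) = v) Fin.valEmbedding
  rw [← hcard]
  have hm : (Finset.univ.filter fun x : Fin (s ^ p) => (x : ℕ) / s ^ (p - u) = v).map
      Fin.valEmbedding = Finset.Ico (v * s ^ (p - u)) ((v + 1) * s ^ (p - u)) := by
    ext x
    simp only [Finset.mem_map, Finset.mem_filter, Finset.mem_univ, true_and,
      Fin.valEmbedding_apply, Finset.mem_Ico]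
    rw [← Nat.le_div_iff_mul_le hP, ← Nat.div_lt_iff_lt_mul hP]
    constructor
    · rintro ⟨y, hy, rfl⟩
      omega
    · intro h
      have hx : x / s ^ (p - u) = v := by omega
      have : x / s ^ (p - u) < s ^ u := by omega
      rw [Nat.div_lt_iff_lt_mul hP, ← hsp] at this
      exact ⟨⟨x, this⟩, hx, rfl⟩
  rw [hm, Nat.card_Ico, ← Nat.sub_mul]
  simp

theorem IsUType.card_filter_div {n s p : ℕ} {κ : Type*} {D : Design n κ s p} (hD : IsUType D)
    (hs : 0 < s) (k : κ) {u v : ℕ} (hu : u ≤ p) (hv : v < s ^ u) :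
    (Finset.univ.filter fun a => (D a k : ℕ) / s ^ (p - u) = v).card * s ^ u = n := by
  have hsp : s ^ u * s ^ (p - u) = s ^ p := by rw [← pow_add, Nat.add_sub_cancel' hu]
  set N := (Finset.univ.filter fun a => D a k = ⟨0, pow_pos hs p⟩).card
  have hN : ∀ w, (Finset.univ.filter fun a => D a k = w).card = N := by
    intro w
    have := hD k w ⟨0, pow_pos hs p⟩
    rwa [Set.ncard_eq_toFinset_card', Set.ncard_eq_toFinset_card', Set.toFinset_ofPred,
      Set.toFinset_ofPred] at this
  have htot : n = s ^ p * N := by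
    have := Finset.card_eq_sum_card_fiberwise (f := fun a => D a k) (s := Finset.univ)
      (t := Finset.univ) (fun _ _ => by simp)
    simpa [hN] using this
  have hf := Finset.card_eq_sum_card_fiberwise (f := fun a => D a k)
    (s := Finset.univ.filter fun a => (D a k : ℕ) / s ^ (p - u) = v)
    (t := Finset.univ.filter fun x : Fin (s ^ p) => (x : ℕ) / s ^ (p - u) = v)
    (fun a ha => by simpa using ha)
  rw [hf, Finset.sum_congr rfl (g := fun _ => N), Finset.sum_const, card_level_filter_div hu hv,
    htot, ← hsp, smul_eq_mul]
  · ring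
  · intro w hw
    rw [← hN w, Finset.filter_filter]
    congr 1
    ext a
    simp only [Finset.mem_filter, Finset.mem_univ, true_and, and_iff_right_iff_imp] at hw ⊢
    rintro rfl
    exact hw

theorem IsUType.sum_deltaRes {n s p : ℕ} {κ : Type*} {D : Design n κ s p} (hD : IsUType D)
    (hs : 0 < s) (k : κ) {i : ℕ} (hi : i ≤ p) (a : Fin n) :
    ∑ b, deltaRes s i (embedPt D a k) (embedPt D b k) = n / (s : ℝ) ^ i := by
  have hlt : (D a k : ℕ) / s ^ (p - i) < s ^ i := (collapse hi (D a k)).isLt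
  have h := hD.card_filter_div hs k hi hlt
  have hs' : (s : ℝ) ^ i ≠ 0 := pow_ne_zero _ (by exact_mod_cast hs.ne')
  simp only [deltaRes_embedPt hs hi, Finset.sum_boole]
  rw [eq_div_iff hs']
  simp only [eq_comm (a := (D a k : ℕ) / s ^ (p - i))]
  exact_mod_cast h

/-- Strata are nested: coincidence at the finer resolution implies it at the coarser one. -/
theorem deltaRes_mul {n s p i j : ℕ} {κ : Type*} (hs : 0 < s) (hij : i ≤ j) (hj : j ≤ p)
    (D : Design n κ s p) (a b : Fin n) (k : κ) :
    deltaRes s i (embedPt D a k) (embedPt D b k) * deltaRes s j (embedPt D a k) (embedPt D b k) =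
      deltaRes s j (embedPt D a k) (embedPt D b k) := by
  rw [deltaRes_embedPt hs hj, deltaRes_embedPt hs (hij.trans hj)]
  by_cases h : (D a k : ℕ) / s ^ (p - j) = (D b k : ℕ) / s ^ (p - j)
  · have h' : p - i = (p - j) + (j - i) := by omega
    rw [if_pos h, mul_one, if_pos]
    rw [h', pow_add, ← Nat.div_div_eq_div_mul, ← Nat.div_div_eq_div_mul, h]
  · rw [if_neg h, mul_zero]

theorem sum_sum_eq_diag_add_upper {p : ℕ} (f : Fin (p + 1) → Fin (p + 1) → ℝ)
    (hf : ∀ i j, f i j = f j i) :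
    ∑ i, ∑ j, f i j = ∑ i, f i i + 2 * ∑ i, ∑ j ∈ Finset.Ioi i, f i j := by
  have h1 : ∀ i, ∑ j, f i j = f i i + ∑ j ∈ Finset.Ioi i, f i j + ∑ j ∈ Finset.Iio i, f i j := by
    intro i
    have hu : (Finset.univ : Finset (Fin (p + 1))) = insert i (Finset.Ioi i ∪ Finset.Iio i) := by
      ext j
      simp only [Finset.mem_univ, Finset.mem_insert, Finset.mem_union, Finset.mem_Ioi,
        Finset.mem_Iio, true_iff]
      rcases lt_trichotomy i j with h | h | h
      · exact Or.inr (Or.inl h)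
      · exact Or.inl h.symm
      · exact Or.inr (Or.inr h)
    rw [hu, Finset.sum_insert (by simp), Finset.sum_union, add_assoc]
    rw [Finset.disjoint_left]
    intro j hj hj'
    exact lt_asymm (Finset.mem_Ioi.1 hj) (Finset.mem_Iio.1 hj')
  have h2 : ∑ i, ∑ j ∈ Finset.Iio i, f i j = ∑ i, ∑ j ∈ Finset.Ioi i, f i j := by
    rw [Finset.sum_comm' (t' := Finset.univ) (s' := fun j => Finset.Ioi j) (by simp)]
    simp only [hf]
  rw [Finset.sum_congr rfl fun i _ => h1 i, Finset.sum_add_distrib, Finset.sum_add_distrib, h2]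
  ring

theorem IsUType.sum_coincidence {n s p : ℕ} {κ : Type*} {D : Design n κ s p} (hD : IsUType D)
    (hs : 0 < s) (ω : Fin (p + 1) → ℝ) (k : κ) :
    ∑ a, ∑ b, coincidence ω D a b k = (n : ℝ) ^ 2 * constA1 s ω := by
  have h : ∀ a, ∑ b, coincidence ω D a b k = n * constA1 s ω := by
    intro a
    unfold coincidence constA1
    rw [Finset.sum_comm, Finset.mul_sum]
    refine Finset.sum_congr rfl fun i _ => ?_
    rw [← Finset.mul_sum, hD.sum_deltaRes hs k i.is_le, two_mul, pow_add]
    ring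
  simp only [h, Finset.sum_const, Finset.card_univ, Fintype.card_fin, nsmul_eq_mul]
  ring

/-- In the expanded square, nesting leaves only the finer of two resolutions, and balance counts it.
The diagonal terms yield `B`, and the pairs `i < j`, occurring twice, yield `2C`. -/
theorem IsUType.sum_coincidence_sq {n s p : ℕ} {κ : Type*} {D : Design n κ s p} (hD : IsUType D)
    (hs : 0 < s) (ω : Fin (p + 1) → ℝ) (k : κ) :
    ∑ a, ∑ b, coincidence ω D a b k ^ 2 = (n : ℝ) ^ 2 * (constB s ω + 2 * constC s ω) := by
  have h : ∀ a, ∑ b, coincidence ω D a b k ^ 2 = n * (constB s ω + 2 * constC s ω) := by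
    intro a
    have hx : ∀ i j : Fin (p + 1), i ≤ j → (∑ b, (ω i / (s : ℝ) ^ (i : ℕ) *
        deltaRes s i (embedPt D a k) (embedPt D b k)) * (ω j / (s : ℝ) ^ (j : ℕ) *
        deltaRes s j (embedPt D a k) (embedPt D b k))) =
        n * (ω i * ω j / (s : ℝ) ^ ((i : ℕ) + 2 * (j : ℕ))) := by
      intro i j hij
      rw [Finset.sum_congr rfl fun b _ => by
        rw [mul_mul_mul_comm, deltaRes_mul hs (Fin.le_iff_val_le_val.1 hij) j.is_le]]
      rw [← Finset.mul_sum, hD.sum_deltaRes hs k j.is_le, two_mul, pow_add, pow_add]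
      ring
    unfold coincidence
    simp only [sq, Finset.sum_mul_sum]
    rw [Finset.sum_comm, Finset.sum_congr rfl fun i _ => Finset.sum_comm,
      sum_sum_eq_diag_add_upper _ (fun i j => Finset.sum_congr rfl fun b _ => mul_comm _ _),
      mul_add, mul_left_comm, constB, constC, Finset.mul_sum (a := (n : ℝ)),
      Finset.mul_sum (a := (n : ℝ))]
    congr 1
    · refine Finset.sum_congr rfl fun i _ => ?_
      rw [hx i i le_rfl, sq]
      congr 3
      ring
    · congr 1
      refine Finset.sum_congr rfl fun i _ => ?_
      rw [Finset.mul_sum]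
      exact Finset.sum_congr rfl fun j hj => hx i j (Finset.mem_Ioi.1 hj).le
  simp only [h, Finset.sum_const, Finset.card_univ, Fintype.card_fin, nsmul_eq_mul]
  ring

/-! ### Equidistance implies attainment of both bounds -/

theorem hierDist_eq {n m s p : ℕ} (ω : Fin (p + 1) → ℝ) (D : Design n (Fin m) s p) (a b : Fin n) :
    hierDist ω D a b = m * constA0 s ω - ∑ k, coincidence ω D a b k := by
  simp only [hierDist, constA0, coincidence, mul_sub, mul_one, Finset.sum_sub_distrib,
    Finset.sum_const, Finset.card_univ, Fintype.card_fin, nsmul_eq_mul]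

theorem IsUType.sum_hierDist {n m s p : ℕ} {D : Design n (Fin m) s p} (hD : IsUType D)
    (hs : 0 < s) (ω : Fin (p + 1) → ℝ) :
    ∑ a, ∑ b, hierDist ω D a b = (n : ℝ) ^ 2 * m * (constA0 s ω - constA1 s ω) := by
  have h : ∑ a, ∑ b, ∑ k, coincidence ω D a b k = m * ((n : ℝ) ^ 2 * constA1 s ω) := by
    have : ∀ a, ∑ b, ∑ k, coincidence ω D a b k = ∑ k, ∑ b, coincidence ω D a b k :=
      fun a => Finset.sum_comm
    simp only [this]
    rw [Finset.sum_comm]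
    simp only [hD.sum_coincidence hs, Finset.sum_const, Finset.card_univ, Fintype.card_fin,
      nsmul_eq_mul]
  simp only [hierDist_eq, Finset.sum_sub_distrib, h, Finset.sum_const, Finset.card_univ,
    Fintype.card_fin, nsmul_eq_mul]
  ring

theorem hierDist_self {n m s p : ℕ} (ω : Fin (p + 1) → ℝ) (D : Design n (Fin m) s p) (a : Fin n) :
    hierDist ω D a a = 0 := by
  simp [hierDist, deltaRes]

/-- Pair products are half of (square of the sum minus sum of squares). Balance fixes the second
part, and the first differs from `G_D` by terms that balance also fixes. -/
theorem IsUType.phiSD_eq {n m s p : ℕ} {D : Design n (Fin m) s p} (hD : IsUType D)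
    (hs : 0 < s) (hn : 0 < n) (hm : 2 ≤ m) (ω : Fin (p + 1) → ℝ) :
    PhiSD ω D = - constA1 s ω ^ 2 + (GD ω D / (n : ℝ) ^ 2
      - (m : ℝ) ^ 2 * constA0 s ω ^ 2 + 2 * (m : ℝ) ^ 2 * constA0 s ω * constA1 s ω
      - m * (constB s ω + 2 * constC s ω)) / (m * (m - 1)) := by
  have hn' : (n : ℝ) ≠ 0 := by exact_mod_cast hn.ne'
  have hm0 : (m : ℝ) ≠ 0 := by
    have : m ≠ 0 := by omega
    exact_mod_cast this
  have hm1 : (m : ℝ) - 1 ≠ 0 := by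
    have : (m : ℝ) ≠ 1 := by
      have : m ≠ 1 := by omega
      exact_mod_cast this
    exact sub_ne_zero.2 this
  have hsd : ∀ v ∈ (Finset.univ : Finset (Fin m)).powersetCard 2,
      sqSD ω (D.submatrix id (fun k : v => (k : Fin m)) : Design n v s p) =
        - constA1 s ω ^ 2 + (∑ a, ∑ b, ∏ k ∈ v, coincidence ω D a b k) / (n : ℝ) ^ 2 := by
    intro v hv
    rw [sqSD_eq hs hn, Fintype.card_coe, (Finset.mem_powersetCard.1 hv).2]
    congr 2
    refine Finset.sum_congr rfl fun a _ => Finset.sum_congr rfl fun b _ => ?_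
    exact Finset.prod_coe_sort v (fun k => coincidence ω D a b k)
  have hcard : (((Finset.univ : Finset (Fin m)).powersetCard 2).card : ℝ) = m * (m - 1) / 2 := by
    rw [Finset.card_powersetCard, Finset.card_univ, Fintype.card_fin, Nat.cast_choose_two]
  have hsq : ∑ a, ∑ b, (∑ k, coincidence ω D a b k) ^ 2 =
      GD ω D - (n : ℝ) ^ 2 * (m : ℝ) ^ 2 * constA0 s ω ^ 2
        + 2 * (n : ℝ) ^ 2 * (m : ℝ) ^ 2 * constA0 s ω * constA1 s ω := by
    have : ∀ a b, (∑ k, coincidence ω D a b k) ^ 2 = (m : ℝ) ^ 2 * constA0 s ω ^ 2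
        - 2 * m * constA0 s ω * hierDist ω D a b + hierDist ω D a b ^ 2 := by
      intro a b
      rw [hierDist_eq]
      ring
    simp only [this, Finset.sum_add_distrib, Finset.sum_sub_distrib, ← Finset.mul_sum,
      hD.sum_hierDist hs ω, Finset.sum_const, Finset.card_univ, Fintype.card_fin, nsmul_eq_mul, GD]
    ring
  have hsq' : ∑ a, ∑ b, ∑ k, coincidence ω D a b k ^ 2 =
      m * ((n : ℝ) ^ 2 * (constB s ω + 2 * constC s ω)) := by
    have : ∀ a, ∑ b, ∑ k, coincidence ω D a b k ^ 2 = ∑ k, ∑ b, coincidence ω D a b k ^ 2 :=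
      fun a => Finset.sum_comm
    simp only [this]
    rw [Finset.sum_comm]
    simp only [hD.sum_coincidence_sq hs, Finset.sum_const, Finset.card_univ, Fintype.card_fin,
      nsmul_eq_mul]
  have hpairs : ∑ v ∈ (Finset.univ : Finset (Fin m)).powersetCard 2,
      ∑ a, ∑ b, ∏ k ∈ v, coincidence ω D a b k =
      (∑ a, ∑ b, (∑ k, coincidence ω D a b k) ^ 2 -
        ∑ a, ∑ b, ∑ k, coincidence ω D a b k ^ 2) / 2 := by
    simp only [sq_sum_eq_add_sum_powersetCard_two, Finset.sum_add_distrib, ← Finset.mul_sum]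
    rw [Finset.sum_comm]
    simp only [Finset.sum_comm (s := (Finset.univ : Finset (Fin m)).powersetCard 2)]
    ring
  unfold PhiSD
  rw [Finset.sum_congr rfl hsd, Finset.sum_add_distrib, Finset.sum_const, nsmul_eq_mul, hcard,
    ← Finset.sum_div, hpairs, hsq, hsq']
  field_simp

/-- A balanced design all of whose pairs of distinct runs are equidistant attains the lower
bounds. -/
theorem IsUType.attainsLowerBounds {n m s p : ℕ} {D : Design n (Fin m) s p} (hD : IsUType D)
    (hs : 0 < s) (hn : 1 < n) (c : ℕ → ℝ)
    (hc : ∀ a b, a ≠ b → ∀ i ≤ p, ((Finset.univ.filter fun k =>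
      (D a k : ℕ) / s ^ (p - i) = (D b k : ℕ) / s ^ (p - i)).card : ℝ) = c i) :
    AttainsLowerBounds D := by
  intro ω _
  set d : ℝ := m * constA0 s ω - ∑ i : Fin (p + 1), ω i / (s : ℝ) ^ (i : ℕ) * c i with hd
  have hn0 : (n : ℝ) ≠ 0 := by
    have : n ≠ 0 := by omega
    exact_mod_cast this
  have hn1 : (n : ℝ) - 1 ≠ 0 := by
    have : (n : ℝ) ≠ 1 := by exact_mod_cast hn.ne'
    exact sub_ne_zero.2 this
  have hdist : ∀ a b, hierDist ω D a b = if a = b then 0 else d := by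
    intro a b
    split_ifs with h
    · rw [h, hierDist_self]
    · rw [hierDist_eq, hd]
      congr 1
      unfold coincidence
      rw [Finset.sum_comm]
      refine Finset.sum_congr rfl fun i _ => ?_
      rw [← Finset.mul_sum, ← hc a b h i i.is_le]
      simp only [deltaRes_embedPt hs i.is_le, Finset.sum_boole]
  have hsum : ∀ t : ℝ, ∑ a : Fin n, ∑ b : Fin n, (if a = b then 0 else t) = n * (n - 1) * t := by
    intro t
    have : ∀ a b : Fin n, (if a = b then 0 else t) = t - if a = b then t else 0 := by
      intro a b
      split_ifs <;> simp
    simp only [this, Finset.sum_sub_distrib, Finset.sum_ite_eq, Finset.mem_univ, if_true,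
      Finset.sum_const, Finset.card_univ, Fintype.card_fin, nsmul_eq_mul]
    ring
  -- The numbers `c i` need not be known: the fixed total, spread over `n (n - 1)` ordered pairs,
  -- determines `d`.
  have hdval : d = n * m * (constA0 s ω - constA1 s ω) / (n - 1) := by
    have := hD.sum_hierDist hs ω
    simp only [hdist, hsum] at this
    rw [eq_div_iff hn1]
    apply mul_left_cancel₀ hn0
    linear_combination this
  have hG : GD ω D = GDLB n m s ω := by
    unfold GD GDLB
    simp only [hdist, ite_pow, ne_eq, OfNat.ofNat_ne_zero, not_false_eq_true, zero_pow, hsum]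
    rw [hdval]
    field_simp
  refine ⟨hG, fun hm => ?_⟩
  have hm0 : (m : ℝ) ≠ 0 := by
    have : m ≠ 0 := by omega
    exact_mod_cast this
  have hm1 : (m : ℝ) - 1 ≠ 0 := by
    have : (m : ℝ) ≠ 1 := by
      have : m ≠ 1 := by omega
      exact_mod_cast this
    exact sub_ne_zero.2 this
  rw [hD.phiSD_eq hs (by omega) hm, hG]
  unfold GDLB PhiSDLB
  field_simp
  ring

/-! ### Strong orthogonality of strengths 1 and 2 -/

theorem IsUType.isOA_collapse_of_card_eq_one {n m s p : ℕ} {D : Design n (Fin m) s p}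
    (hD : IsUType D) (hs : 0 < s) (S : Finset (Fin m)) (hS : S.card = 1) (u : S → ℕ)
    (hu : ∀ k, u k ≤ p) :
    IsOA (L := fun k : S => s ^ u k) (fun a k => collapse (hu k) (D a k)) S.card := by
  intro T hT c c'
  rw [hS] at hT
  obtain ⟨k, rfl⟩ := Finset.card_eq_one.1 hT
  have key : ∀ c : (j : ({k} : Finset S)) → Fin (s ^ u j),
      {a | ∀ j : ({k} : Finset S), collapse (hu j) (D a j) = c j}.ncard * s ^ u k = n := by
    intro c
    rw [Set.ncard_eq_toFinset_card', Set.toFinset_ofPred]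
    convert hD.card_filter_div hs (k : Fin m) (hu k)
      (c ⟨k, Finset.mem_singleton_self k⟩).isLt using 4 with a
    constructor
    · intro h
      exact congrArg Fin.val (h ⟨k, Finset.mem_singleton_self k⟩)
    · rintro h ⟨j, hj⟩
      obtain rfl := Finset.mem_singleton.1 hj
      exact Fin.ext h
  exact Nat.eq_of_mul_eq_mul_right (pow_pos hs (u k)) ((key c).trans (key c').symm)

theorem IsUType.isGSOA_one {n m s p : ℕ} {D : Design n (Fin m) s p} (hD : IsUType D)
    (hs : 0 < s) : IsGSOA D 1 := by
  intro S h1 h2 u _ hu _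
  exact hD.isOA_collapse_of_card_eq_one hs S (le_antisymm h2 h1) u hu

/-- The only compositions of 2 are `2` and `1 + 1`. The first concerns a single column and follows
from balance; the second involves only leading digits, which `hN` controls. -/
theorem IsUType.isGSOA_two {n m s p : ℕ} {D : Design n (Fin m) s p} (hD : IsUType D)
    (hs : 0 < s) (N : ℕ)
    (hN : ∀ j k : Fin m, j ≠ k → ∀ v < s, ∀ w < s, (Finset.univ.filter fun a =>
      (D a j : ℕ) / s ^ (p - 1) = v ∧ (D a k : ℕ) / s ^ (p - 1) = w).card = N) :
    IsGSOA D 2 := by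
  intro S h1 h2 u hu1 hu hsum
  rcases Nat.lt_or_ge S.card 2 with h | h
  · exact hD.isOA_collapse_of_card_eq_one hs S (by omega) u hu
  have hcard : S.card = 2 := le_antisymm h2 h
  have hu' : ∀ k, u k = 1 := by
    have h1sum : ∑ k : S, 1 = ∑ k : S, u k := by
      rw [hsum]
      simp [hcard]
    intro k
    exact ((Finset.sum_eq_sum_iff_of_le fun k _ => hu1 k).1 h1sum k (Finset.mem_univ k)).symm
  intro T hT c c'
  have hTu : T = Finset.univ := by
    rw [← Finset.card_eq_iff_eq_univ, hT, Fintype.card_coe]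
  subst hTu
  obtain ⟨j, k, hjk, rfl⟩ := Finset.card_eq_two.1 hcard
  have key : ∀ c : (i : (Finset.univ : Finset ({j, k} : Finset (Fin m)))) → Fin (s ^ u i),
      {a | ∀ i : (Finset.univ : Finset ({j, k} : Finset (Fin m))),
        collapse (hu i) (D a i) = c i}.ncard = N := by
    intro c
    have hlt : ∀ i, (c i : ℕ) < s := by
      intro i
      exact (c i).isLt.trans_eq (by rw [hu', pow_one])
    rw [Set.ncard_eq_toFinset_card', Set.toFinset_ofPred, ← hN j k hjk
      _ (hlt ⟨⟨j, by simp⟩, by simp⟩) _ (hlt ⟨⟨k, by simp⟩, by simp⟩)]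
    congr 1
    ext a
    simp only [Finset.mem_filter, Finset.mem_univ, true_and, Fin.ext_iff, collapse, hu']
    constructor
    · intro h
      exact ⟨h ⟨⟨j, by simp⟩, by simp⟩, h ⟨⟨k, by simp⟩, by simp⟩⟩
    · rintro ⟨h, h'⟩ ⟨⟨i, hi⟩, hi'⟩
      rcases Finset.mem_insert.1 hi with rfl | hi
      · exact h
      · obtain rfl := Finset.mem_singleton.1 hi
        exact h'
  rw [key, key]

/-! ### Designs given by digit strings -/

/-- The number whose base-`s` digits, from the most significant one on, are
`d 0, …, d (i - 1)`. -/
def radixVal (s : ℕ) (d : ℕ → ℕ) : ℕ → ℕ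
  | 0 => 0
  | i + 1 => radixVal s d i * s + d i

theorem radixVal_lt {s : ℕ} {d : ℕ → ℕ} (hd : ∀ j, d j < s) (i : ℕ) : radixVal s d i < s ^ i := by
  induction i with
  | zero => simp [radixVal]
  | succ i ih =>
    rw [radixVal, pow_succ]
    have := hd i
    nlinarith

theorem radixVal_add_div {s : ℕ} {d : ℕ → ℕ} (hd : ∀ j, d j < s) (i j : ℕ) :
    radixVal s d (i + j) / s ^ j = radixVal s d i := by
  induction j with
  | zero => simp
  | succ j ih =>
    have hs : 0 < s := (Nat.zero_le _).trans_lt (hd 0)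
    rw [← add_assoc, radixVal, pow_succ', ← Nat.div_div_eq_div_mul, mul_comm,
      Nat.mul_add_div hs, Nat.div_eq_of_lt (hd _), add_zero, ih]

theorem radixVal_eq_iff {s : ℕ} {d d' : ℕ → ℕ} (hd : ∀ j, d j < s) (hd' : ∀ j, d' j < s) (i : ℕ) :
    radixVal s d i = radixVal s d' i ↔ ∀ j < i, d j = d' j := by
  induction i with
  | zero => simp [radixVal]
  | succ i ih =>
    have hs : 0 < s := (Nat.zero_le _).trans_lt (hd 0)
    rw [Nat.forall_lt_succ_right, ← ih, radixVal, radixVal]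
    constructor
    · intro h
      have h1 := congrArg (· / s) h
      have h2 := congrArg (· % s) h
      simp only [mul_comm _ s, Nat.mul_add_div hs, Nat.div_eq_of_lt (hd i),
        Nat.div_eq_of_lt (hd' i), add_zero, Nat.mul_add_mod, Nat.mod_eq_of_lt (hd i),
        Nat.mod_eq_of_lt (hd' i)] at h1 h2
      exact ⟨h1, h2⟩
    · rintro ⟨h1, h2⟩
      rw [h1, h2]

/-- The design whose entry in row `a` and column `k` has the base-`s` digits
`X a k 0, …, X a k (p - 1)`. -/
def digitDesign {n s : ℕ} {κ : Type*} (p : ℕ) (X : Fin n → κ → ℕ → Fin s) : Design n κ s p :=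
  fun a k => ⟨radixVal s (fun j => X a k j) p, radixVal_lt (fun j => (X a k j).isLt) p⟩

theorem digitDesign_div {n s p : ℕ} {κ : Type*} (X : Fin n → κ → ℕ → Fin s) {i : ℕ} (hi : i ≤ p)
    (a : Fin n) (k : κ) :
    (digitDesign p X a k : ℕ) / s ^ (p - i) = radixVal s (fun j => X a k j) i := by
  have := radixVal_add_div (fun j => (X a k j).isLt) i (p - i)
  rwa [Nat.add_sub_cancel' hi] at this

/-- Collapsing truncates the digit string, so coincidence at resolution `i` is agreement of the
leading `i` digits. -/
theorem digitDesign_div_eq_iff {n s p : ℕ} {κ : Type*} (X : Fin n → κ → ℕ → Fin s) {i : ℕ}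
    (hi : i ≤ p) (a b : Fin n) (k : κ) :
    (digitDesign p X a k : ℕ) / s ^ (p - i) = (digitDesign p X b k : ℕ) / s ^ (p - i) ↔
      ∀ j < i, X a k j = X b k j := by
  rw [digitDesign_div X hi, digitDesign_div X hi,
    radixVal_eq_iff (fun j => (X a k j).isLt) (fun j => (X b k j).isLt)]
  simp only [Fin.val_inj]

theorem digitDesign_div_one {n s p : ℕ} {κ : Type*} (X : Fin n → κ → ℕ → Fin s) (hp : 1 ≤ p)
    (a : Fin n) (k : κ) :
    (digitDesign p X a k : ℕ) / s ^ (p - 1) = X a k 0 := by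
  rw [digitDesign_div X hp]
  simp [radixVal]

theorem exists_radixVal_eq {s p : ℕ} (hs : 0 < s) (v : Fin (s ^ p)) :
    ∃ d : ℕ → Fin s, radixVal s (fun j => d j) p = v := by
  -- Digits from position `p` on are never read; zero is an arbitrary filler. Surjectivity then
  -- follows from injectivity by counting.
  let ext : (Fin p → Fin s) → ℕ → Fin s := fun c j => if h : j < p then c ⟨j, h⟩ else ⟨0, hs⟩
  let f : (Fin p → Fin s) → Fin (s ^ p) := fun c =>
    ⟨radixVal s (fun j => ext c j) p, radixVal_lt (fun j => (ext c j).isLt) p⟩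
  have hf : Function.Bijective f := by
    rw [Fintype.bijective_iff_injective_and_card]
    refine ⟨fun c c' h => ?_, by simp⟩
    have h' := (radixVal_eq_iff (fun j => (ext c j).isLt) (fun j => (ext c' j).isLt) p).1
      (Fin.ext_iff.1 h)
    funext j
    have := Fin.ext (h' j j.isLt)
    simpa [ext] using this
  obtain ⟨c, hc⟩ := hf.2 v
  exact ⟨ext c, congrArg Fin.val hc⟩

theorem isUType_digitDesign {n s p : ℕ} {κ : Type*} (hs : 0 < s) (X : Fin n → κ → ℕ → Fin s)
    (N : ℕ) (hN : ∀ k, ∀ d : ℕ → Fin s,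
      (Finset.univ.filter fun a => ∀ j < p, X a k j = d j).card = N) :
    IsUType (digitDesign p X) := by
  have key : ∀ k, ∀ v, {a | digitDesign p X a k = v}.ncard = N := by
    intro k v
    obtain ⟨d, hd⟩ := exists_radixVal_eq hs v
    rw [← hN k d, Set.ncard_eq_toFinset_card', Set.toFinset_ofPred]
    congr 1
    ext a
    simp only [Finset.mem_filter, Finset.mem_univ, true_and, Fin.ext_iff, ← hd]
    exact radixVal_eq_iff (fun j => (X a k j).isLt) (fun j => (d j).isLt) p
  intro k v w
  rw [key, key]

/-! ### Row differences of a generalized Hadamard matrix -/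

/-- For a nontrivial additive character `χ`, uniform column differences say that `M = χ(H)`
satisfies `M* M = n I`. Then `M M* = n I` too, so every nontrivial character sum over a row
difference vanishes, and Fourier inversion makes that difference uniform. -/
theorem card_filter_sub_transpose {ι F : Type*} [Fintype ι] [DecidableEq ι] [Field F] [Fintype F]
    [DecidableEq F] (H : Matrix ι ι F) (l : ℕ) (hl : 1 ≤ l)
    (hcard : Fintype.card ι = l * Fintype.card F)
    (hH : ∀ j k, j ≠ k → ∀ g, (Finset.univ.filter fun i => H i j - H i k = g).card = l)
    (a b : ι) (hab : a ≠ b) (g : F) :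
    (Finset.univ.filter fun k => H a k - H b k = g).card = l := by
  have hfib : ∀ (f : ι → F) (χ : AddChar F ℂ), ∑ i, χ (f i) =
      ∑ x, ((Finset.univ.filter fun i => f i = x).card : ℂ) * χ x := by
    intro f χ
    rw [← Finset.sum_fiberwise_of_maps_to (s := Finset.univ) (t := Finset.univ) (g := f)
      (fun _ _ => Finset.mem_univ _)]
    refine Finset.sum_congr rfl fun x _ => ?_
    rw [Finset.sum_congr rfl (g := fun _ => χ x)]
    · rw [Finset.sum_const, nsmul_eq_mul]
    · intro i hi
      rw [(Finset.mem_filter.1 hi).2]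
  have hn : (Fintype.card ι : ℂ) ≠ 0 := by
    have : 0 < Fintype.card F := Fintype.card_pos
    have : 0 < Fintype.card ι := hcard ▸ Nat.mul_pos hl this
    exact_mod_cast this.ne'
  have hrow : ∀ χ : AddChar F ℂ, χ ≠ 0 → ∑ k, χ (H a k - H b k) = 0 := by
    intro χ hχ
    have hM : (Matrix.of fun i j => χ (-H j i)) * (Matrix.of fun i j => χ (H i j)) =
        (Fintype.card ι : ℂ) • (1 : Matrix ι ι ℂ) := by
      ext j k
      simp only [Matrix.mul_apply, Matrix.of_apply, ← AddChar.map_add_eq_mul, Matrix.smul_apply,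
        Matrix.one_apply, smul_eq_mul]
      by_cases h : j = k
      · simp [h]
      · simp only [neg_add_eq_sub]
        rw [hfib]
        simp only [hH k j (Ne.symm h), ← Finset.mul_sum]
        rw [AddChar.sum_eq_zero_iff_ne_zero.2 hχ]
        simp [h]
    have h1 : ((Fintype.card ι : ℂ)⁻¹ • Matrix.of fun i j => χ (-H j i)) *
        (Matrix.of fun i j => χ (H i j)) = 1 := by
      rw [Matrix.smul_mul, hM, smul_smul, inv_mul_cancel₀ hn, one_smul]
    -- A one-sided inverse of a square matrix is two-sided; this passes from columns to rows.
    rw [mul_eq_one_comm] at h1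
    have h2 := congrFun (congrFun h1 a) b
    rw [Matrix.one_apply_ne hab, Matrix.mul_smul, Matrix.smul_apply, smul_eq_mul,
      mul_eq_zero, or_iff_right (inv_ne_zero hn)] at h2
    simpa only [Matrix.mul_apply, Matrix.of_apply, ← AddChar.map_add_eq_mul,
      ← sub_eq_add_neg] using h2
  have hinv : ∑ χ : AddChar F ℂ, ∑ k, χ (H a k - H b k - g) =
      Fintype.card F * ((Finset.univ.filter fun k => H a k - H b k = g).card : ℂ) := by
    rw [Finset.sum_comm]
    simp only [AddChar.sum_apply_eq_ite, sub_eq_zero (b := g)]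
    rw [← Finset.sum_filter, Finset.sum_const, nsmul_eq_mul, mul_comm]
  -- Only the trivial character contributes.
  have hzero : ∑ χ : AddChar F ℂ, ∑ k, χ (H a k - H b k - g) = Fintype.card ι := by
    rw [Finset.sum_eq_single 0]
    · simp
    · intro χ _ hχ
      simp only [sub_eq_add_neg (b := g), AddChar.map_add_eq_mul χ _ (-g), ← Finset.sum_mul,
        hrow χ hχ, zero_mul]
    · simp
  have hF : (Fintype.card F : ℂ) ≠ 0 := by exact_mod_cast Fintype.card_ne_zero
  have := hinv.symm.trans hzero
  rw [hcard] at this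
  push_cast at this
  have h3 := mul_left_cancel₀ hF (this.trans (mul_comm _ _))
  exact_mod_cast h3

/-! ### Field elements as digit vectors, and counting -/

theorem exists_field_card_eq {s : ℕ} (hs : IsPrimePow s) :
    ∃ (G : Type) (_ : Field G) (_ : Fintype G), Fintype.card G = s := by
  obtain ⟨ρ, r, hρ, hr, rfl⟩ := hs
  have : Fact ρ.Prime := ⟨hρ.nat_prime⟩
  have : Fintype (GaloisField ρ r) := Fintype.ofFinite _
  exact ⟨GaloisField ρ r, inferInstance, inferInstance, by
    rw [← Nat.card_eq_fintype_card, GaloisField.card ρ r hr.ne']⟩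

theorem nonempty_addEquiv_of_card_eq_prime_pow {ρ : ℕ} (hρ : ρ.Prime) {r : ℕ} {F V : Type*}
    [AddCommGroup F] [AddCommGroup V] [Finite F] [Finite V] [Module (ZMod ρ) F]
    [Module (ZMod ρ) V] (hF : Nat.card F = ρ ^ r) (hV : Nat.card V = ρ ^ r) :
    Nonempty (F ≃+ V) := by
  have : Fact ρ.Prime := ⟨hρ⟩
  have h : Module.finrank (ZMod ρ) F = Module.finrank (ZMod ρ) V := by
    apply Nat.pow_right_injective hρ.two_le
    change ρ ^ _ = ρ ^ _
    have h1 := Module.natCard_eq_pow_finrank (K := ZMod ρ) (V := F)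
    have h2 := Module.natCard_eq_pow_finrank (K := ZMod ρ) (V := V)
    rw [Nat.card_zmod] at h1 h2
    rw [← h1, ← h2, hF, hV]
  exact ⟨(LinearEquiv.ofFinrankEq F V h).toAddEquiv⟩

/-- Only addition matters for differences, and both sides are vector spaces over `ZMod ρ` of the
same order. No embedding of `G` into `F` is required. -/
theorem exists_addEquiv_pi {s p : ℕ} (hs : IsPrimePow s) (F : Type*) [Field F] [Fintype F]
    (hF : Fintype.card F = s ^ p) :
    ∃ (G : Type) (_ : Field G) (_ : Fintype G), Fintype.card G = s ∧
      Nonempty (F ≃+ (Fin p → G)) := by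
  obtain ⟨G, _, _, hG⟩ := exists_field_card_eq hs
  refine ⟨G, inferInstance, inferInstance, hG, ?_⟩
  obtain ⟨ρ, r, hρ, hr, rfl⟩ := hs
  have hρ := hρ.nat_prime
  have : Fact ρ.Prime := ⟨hρ⟩
  have := charP_of_card_eq_prime_pow hG
  have := charP_of_card_eq_prime_pow (hF.trans (pow_mul ρ r p).symm)
  let _ := ZMod.algebra F ρ
  let _ := ZMod.algebra G ρ
  apply nonempty_addEquiv_of_card_eq_prime_pow hρ (r := r * p)
  · rw [Nat.card_eq_fintype_card, hF, pow_mul]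
  · rw [Nat.card_eq_fintype_card, Fintype.card_fun, hG, Fintype.card_fin, pow_mul]

theorem card_filter_mem_of_uniform {ι F : Type*} [Fintype ι] [Fintype F] [DecidableEq F]
    (f : ι → F) (l : ℕ) (hf : ∀ g, (Finset.univ.filter fun i => f i = g).card = l)
    (P : F → Prop) [DecidablePred P] :
    (Finset.univ.filter fun i => P (f i)).card = l * (Finset.univ.filter P).card := by
  have h := Finset.card_eq_sum_card_fiberwise (f := f) (s := Finset.univ.filter fun i => P (f i))
    (t := Finset.univ.filter P) (fun i hi => by simpa using hi)
  rw [h, Finset.sum_congr rfl (g := fun _ => l), Finset.sum_const, smul_eq_mul, mul_comm]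
  intro x hx
  rw [← hf x, Finset.filter_filter]
  congr 1
  ext i
  simp only [Finset.mem_filter, Finset.mem_univ, true_and, and_iff_right_iff_imp] at hx ⊢
  rintro rfl
  exact hx

theorem card_filter_pi_prefix {G : Type*} [Fintype G] [DecidableEq G] {p i : ℕ} (hi : i ≤ p)
    (d : Fin p → G) :
    (Finset.univ.filter fun x : Fin p → G => ∀ j : Fin p, (j : ℕ) < i → x j = d j).card =
      Fintype.card G ^ (p - i) := by
  have h : (Finset.univ.filter fun x : Fin p → G => ∀ j : Fin p, (j : ℕ) < i → x j = d j) =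
      Fintype.piFinset fun j : Fin p => if (j : ℕ) < i then {d j} else Finset.univ := by
    ext x
    simp only [Finset.mem_filter, Finset.mem_univ, true_and, Fintype.mem_piFinset]
    refine forall_congr' fun j => ?_
    split_ifs with h <;> simp [h]
  rw [h, Fintype.card_piFinset]
  have h2 : ∀ j : Fin p, (if (j : ℕ) < i then ({d j} : Finset G) else Finset.univ).card =
      if (j : ℕ) < i then 1 else Fintype.card G := by
    intro j
    split_ifs <;> simp
  simp only [h2]
  rw [Fin.prod_univ_eq_prod_range (fun j => if j < i then 1 else Fintype.card G) p,
    ← Finset.prod_range_mul_prod_Ico _ hi,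
    Finset.prod_congr rfl (g := fun _ => 1) (fun j hj => if_pos (Finset.mem_range.1 hj)),
    Finset.prod_congr (s₁ := Finset.Ico i p) rfl (g := fun _ => Fintype.card G)
      (fun j hj => if_neg (Finset.mem_Ico.1 hj).1.not_gt)]
  simp

/-- A 2 × 2 table with all margins `N` has equal diagonal entries and equal off-diagonal ones; a
diagonal total of `N` then makes all four equal. With more levels these counts no longer determine
the table, hence the special role of `s = 2`. -/
theorem card_filter_pair_of_uniform {ι : Type*} [Fintype ι] (f g : ι → Fin 2) (N : ℕ)
    (hf : ∀ v, (Finset.univ.filter fun i => f i = v).card = N)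
    (hg : ∀ v, (Finset.univ.filter fun i => g i = v).card = N)
    (hfg : (Finset.univ.filter fun i => f i = g i).card = N) (v w : Fin 2) :
    (Finset.univ.filter fun i => f i = v ∧ g i = w).card = N / 2 := by
  have h1 : ∀ v, N = (Finset.univ.filter fun i => f i = v ∧ g i = 0).card +
      (Finset.univ.filter fun i => f i = v ∧ g i = 1).card := by
    intro v
    rw [← hf v, ← Finset.card_filter_add_card_filter_not (fun i => g i = 0), Finset.filter_filter,
      Finset.filter_filter]
    congr 3
    ext i
    have : g i ≠ 0 ↔ g i = 1 := by omega
    simp [this]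
  have h2 : ∀ v, N = (Finset.univ.filter fun i => f i = 0 ∧ g i = v).card +
      (Finset.univ.filter fun i => f i = 1 ∧ g i = v).card := by
    intro v
    rw [← hg v, ← Finset.card_filter_add_card_filter_not (fun i => f i = 0), Finset.filter_filter,
      Finset.filter_filter]
    congr 3
    · ext i
      simp [and_comm]
    · ext i
      have : f i ≠ 0 ↔ f i = 1 := by omega
      simp [this, and_comm]
  have h3 : N = (Finset.univ.filter fun i => f i = 0 ∧ g i = 0).card +
      (Finset.univ.filter fun i => f i = 1 ∧ g i = 1).card := by
    rw [← hfg, ← Finset.card_filter_add_card_filter_not (fun i => f i = 0), Finset.filter_filter,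
      Finset.filter_filter]
    congr 2
    · ext i
      simp only [Finset.mem_filter, Finset.mem_univ, true_and]
      omega
    · ext i
      simp only [Finset.mem_filter, Finset.mem_univ, true_and]
      omega
  have := h1 0
  have := h1 1
  have := h2 0
  have := h2 1
  fin_cases v <;> fin_cases w <;> simp only [Fin.zero_eta, Fin.mk_one] <;> omega

/-! ### Designs from generalized Hadamard matrices -/

theorem exists_design_of_generalizedHadamard {s N l p q : ℕ} (hs : IsPrimePow s) (hl : 1 ≤ l)
    (hq : 1 ≤ q) (hqp : q ≤ p) {F : Type*} [Field F] [Fintype F] [DecidableEq F]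
    (hF : Fintype.card F = s ^ p) (hN : N + 1 = l * s ^ p)
    (H : Matrix (Fin (N + 1)) (Fin (N + 1)) F)
    (hH : ∀ j k, j ≠ k → ∀ g, (Finset.univ.filter fun i => H i j - H i k = g).card = l) :
    ∃ D : Design (N + 1) (Fin N) s q,
      IsGSOA D (if s = 2 then 2 else 1) ∧ IsUType D ∧ AttainsLowerBounds D := by
  classical
  have hs2 : 2 ≤ s := hs.two_le
  have hs0 : 0 < s := by omega
  obtain ⟨G, _, _, hG, ⟨φ⟩⟩ := exists_addEquiv_pi hs F hF
  let e : G ≃ Fin s := Fintype.equivFinOfCardEq hG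
  let dig : F → ℕ → Fin s := fun x j => if h : j < p then e (φ x ⟨j, h⟩) else ⟨0, hs0⟩
  have hdig : ∀ i ≤ p, ∀ x y, (∀ j < i, dig x j = dig y j) ↔
      ∀ j : Fin p, (j : ℕ) < i → φ x j = φ y j := by
    intro i hi x y
    constructor
    · intro h j hj
      have := h j hj
      simpa [dig] using this
    · intro h j hj
      have hjp : j < p := by omega
      simp only [dig, dif_pos hjp, h ⟨j, hjp⟩ hj]
  have hcount : ∀ i ≤ p, ∀ d : ℕ → Fin s,
      (Finset.univ.filter fun x => ∀ j < i, dig x j = d j).card = s ^ (p - i) := by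
    intro i hi d
    have hpi := card_filter_pi_prefix hi (fun j => e.symm (d j))
    rw [hG] at hpi
    rw [← hpi]
    refine Finset.card_bijective φ φ.bijective fun x => ?_
    simp only [Finset.mem_filter, Finset.mem_univ, true_and]
    constructor
    · intro h j hj
      rw [← h j hj]
      simp [dig]
    · intro h j hj
      have hjp : j < p := by omega
      simp only [dig, dif_pos hjp, h ⟨j, hjp⟩ hj, Equiv.apply_symm_apply]
  -- Subtracting column `0` makes each remaining column a column difference, hence uniform. Column
  -- `0` itself becomes zero and is dropped.
  let X : Fin (N + 1) → Fin N → ℕ → Fin s := fun a k j => dig (H a k.succ - H a 0) j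
  have hcol : ∀ k, ∀ i ≤ p, ∀ d : ℕ → Fin s,
      (Finset.univ.filter fun a => ∀ j < i, X a k j = d j).card = l * s ^ (p - i) := by
    intro k i hi d
    rw [← hcount i hi d]
    exact card_filter_mem_of_uniform (fun a => H a k.succ - H a 0) l
      (hH _ _ (Fin.succ_ne_zero k)) (fun x => ∀ j < i, dig x j = d j)
  have hrow : ∀ a b, a ≠ b → ∀ i ≤ p,
      -- The `+ 1` is the dropped column, in which all runs agree.
      (Finset.univ.filter fun k => ∀ j < i, X a k j = X b k j).card + 1 = l * s ^ (p - i) := by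
    intro a b hab i hi
    have hfull : (Finset.univ.filter fun k => ∀ j < i,
        dig (H a k - H a 0) j = dig (H b k - H b 0) j).card = l * s ^ (p - i) := by
      -- Since `φ` is additive, agreement in column `k` means that `H a k - H b k` shares its first
      -- `i` digits with the fixed element `H a 0 - H b 0`.
      rw [← hcount i hi (dig (H a 0 - H b 0)), ← card_filter_mem_of_uniform
        (fun k => H a k - H b k) l (fun g => card_filter_sub_transpose H l hl
          (by rw [Fintype.card_fin, hF, hN]) hH a b hab g)]
      congr 1
      ext k
      simp only [Finset.mem_filter, Finset.mem_univ, true_and, hdig i hi]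
      refine forall_congr' fun j => imp_congr_right fun _ => ?_
      simp only [map_sub, Pi.sub_apply]
      rw [sub_eq_sub_iff_sub_eq_sub]
    rw [Fin.card_filter_univ_succ, if_pos (by simp)] at hfull
    exact hfull
  have hU : IsUType (digitDesign q X) :=
    isUType_digitDesign hs0 X (l * s ^ (p - q)) fun k d => hcol k q hqp d
  refine ⟨digitDesign q X, ?_, hU, ?_⟩
  · split_ifs with h2
    · subst h2
      refine hU.isGSOA_two hs0 (l * 2 ^ (p - 1) / 2) fun j k hjk v hv w hw => ?_
      have hone : ∀ k v, (Finset.univ.filter fun a => X a k 0 = v).card = l * 2 ^ (p - 1) := by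
        intro k v
        simpa using hcol k 1 (hq.trans hqp) (fun _ => v)
      -- Column `0` cancels: the leading digits agree when the difference of the two original
      -- columns has the leading digit of zero.
      have heq : (Finset.univ.filter fun a => X a j 0 = X a k 0).card = l * 2 ^ (p - 1) := by
        rw [← hcount 1 (hq.trans hqp) (dig 0), ← card_filter_mem_of_uniform
          (fun a => H a j.succ - H a k.succ) l (hH _ _ (by simpa using hjk))]
        congr 1
        ext a
        have h1 := hdig 1 (hq.trans hqp) (H a j.succ - H a 0) (H a k.succ - H a 0)
        simp only [Nat.lt_one_iff, forall_eq] at h1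
        simp only [Finset.mem_filter, Finset.mem_univ, true_and, hdig 1 (hq.trans hqp)]
        refine h1.trans ?_
        simp only [Nat.lt_one_iff]
        refine forall_congr' fun i => imp_congr_right fun _ => ?_
        simp [sub_eq_zero]
      rw [← card_filter_pair_of_uniform (fun a => X a j 0) (fun a => X a k 0) _ (hone j) (hone k)
        heq ⟨v, hv⟩ ⟨w, hw⟩]
      simp only [digitDesign_div_one X hq, Fin.ext_iff]
    · exact hU.isGSOA_one hs0
  -- The exponent involves `p`, not `q`: the first `i ≤ q` digits are constrained among all `p`
  -- digits of a field element.
  · refine hU.attainsLowerBounds hs0 ?_ (fun i => (l * s ^ (p - i) : ℕ) - 1) fun a b hab i hi => ?_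
    · have := Nat.le_self_pow (show p ≠ 0 by omega) s
      rw [hN]
      nlinarith
    · simp only [digitDesign_div_eq_iff X hi]
      rw [← hrow a b hab i (hi.trans hqp)]
      push_cast
      ring

/-! ### The design from the affine plane -/

theorem card_filter_eq_one {ι : Type*} [Fintype ι] (P : ι → Prop) [DecidablePred P] (z : ι)
    (h : ∀ w, P w ↔ w = z) : (Finset.univ.filter P).card = 1 := by
  rw [Finset.card_eq_one]
  exact ⟨z, by ext w; simp [h]⟩

/-- The linear forms `y` and `x + c y`, which represent the points of the projective line. -/
def projForm {G : Type*} [Field G] : Option G → G × G → G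
  | none, z => z.2
  | some c, z => z.1 + c * z.2

/-- A linear form complementary to `projForm`. -/
def coForm {G : Type*} [Field G] : Option G → G × G → G
  | none, z => z.1
  | some _, z => z.2

theorem exists_projForm_coForm_iff {G : Type*} [Field G] (o : Option G) (v w : G) :
    ∃ z, ∀ x, projForm o x = v ∧ coForm o x = w ↔ x = z := by
  cases o with
  | none =>
    refine ⟨(w, v), fun x => ?_⟩
    simp only [projForm, coForm, Prod.ext_iff, and_comm]
  | some c =>
    refine ⟨(v - c * w, w), fun x => ?_⟩
    simp only [projForm, coForm, Prod.ext_iff, eq_sub_iff_add_eq]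
    constructor <;> (rintro ⟨h, rfl⟩; exact ⟨h, rfl⟩)

theorem exists_projForm_projForm_iff {G : Type*} [Field G] {o o' : Option G} (h : o ≠ o')
    (v w : G) : ∃ z, ∀ x, projForm o x = v ∧ projForm o' x = w ↔ x = z := by
  cases o with
  | none =>
    cases o' with
    | none => exact absurd rfl h
    | some c =>
      refine ⟨(w - c * v, v), fun x => ?_⟩
      simp only [projForm, Prod.ext_iff, eq_sub_iff_add_eq]
      constructor
      · rintro ⟨rfl, h⟩
        exact ⟨h, rfl⟩
      · rintro ⟨h, rfl⟩
        exact ⟨rfl, h⟩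
  | some c =>
    cases o' with
    | none =>
      refine ⟨(v - c * w, w), fun x => ?_⟩
      simp only [projForm, Prod.ext_iff, eq_sub_iff_add_eq]
      constructor <;> (rintro ⟨h, rfl⟩; exact ⟨h, rfl⟩)
    | some c' =>
      have hc : c - c' ≠ 0 := sub_ne_zero.2 fun h' => h (by rw [h'])
      refine ⟨(v - c * ((v - w) / (c - c')), (v - w) / (c - c')), fun x => ?_⟩
      simp only [projForm, Prod.ext_iff]
      constructor
      · rintro ⟨rfl, rfl⟩
        have : x.2 = (x.1 + c * x.2 - (x.1 + c' * x.2)) / (c - c') := by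
          rw [eq_div_iff hc]
          ring
        rw [← this]
        exact ⟨by ring, rfl⟩
      · rintro ⟨h1, h2⟩
        rw [h1, h2]
        constructor
        · ring
        · field_simp
          ring

/-- Up to scalars exactly one linear form vanishes on the nonzero vector `x - y`: two points lie on
one common line. -/
theorem exists_projForm_eq_iff {G : Type*} [Field G] {x y : G × G} (h : x ≠ y) :
    ∃ o, ∀ o', projForm o' x = projForm o' y ↔ o' = o := by
  by_cases h2 : x.2 = y.2
  · refine ⟨none, fun o' => ?_⟩
    have h1 : x.1 ≠ y.1 := fun h1 => h (Prod.ext h1 h2)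
    cases o' with
    | none => simp [projForm, h2]
    | some c => simp [projForm, h2, h1]
  · have hd : x.2 - y.2 ≠ 0 := sub_ne_zero.2 h2
    refine ⟨some ((y.1 - x.1) / (x.2 - y.2)), fun o' => ?_⟩
    cases o' with
    | none => simp [projForm, h2]
    | some c =>
      simp only [projForm, Option.some_inj, eq_div_iff hd]
      constructor <;> intro h <;> linear_combination h

theorem exists_design_projective_line {s : ℕ} (hs : IsPrimePow s) :
    ∃ D : Design (s ^ 2) (Fin (s + 1)) s 2,
      IsGSOA D 2 ∧ IsUType D ∧ AttainsLowerBounds D := by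
  classical
  have hs2 : 2 ≤ s := hs.two_le
  have hs0 : 0 < s := by omega
  obtain ⟨G, _, _, hG⟩ := exists_field_card_eq hs
  let e : G ≃ Fin s := Fintype.equivFinOfCardEq hG
  let r : Fin (s ^ 2) ≃ G × G :=
    (Fintype.equivFinOfCardEq (by rw [Fintype.card_prod, hG, sq])).symm
  let κ : Fin (s + 1) ≃ Option G := (Fintype.equivFinOfCardEq (by rw [Fintype.card_option, hG])).symm
  let X : Fin (s ^ 2) → Fin (s + 1) → ℕ → Fin s := fun a k j =>
    if j = 0 then e (projForm (κ k) (r a)) else e (coForm (κ k) (r a))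
  have hU : IsUType (digitDesign 2 X) := by
    refine isUType_digitDesign hs0 X 1 fun k d => ?_
    obtain ⟨z, hz⟩ := exists_projForm_coForm_iff (κ k) (e.symm (d 0)) (e.symm (d 1))
    refine card_filter_eq_one _ (r.symm z) fun a => ?_
    rw [r.eq_symm_apply, ← hz, e.eq_symm_apply, e.eq_symm_apply]
    constructor
    · intro h
      exact ⟨h 0 two_pos, h 1 one_lt_two⟩
    · rintro ⟨h0, h1⟩ j hj
      interval_cases j
      exacts [h0, h1]
  refine ⟨digitDesign 2 X, hU.isGSOA_two hs0 1 fun j k hjk v hv w hw => ?_, hU,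
    hU.attainsLowerBounds hs0 (by nlinarith)
      -- Distinct points agree trivially in all `s + 1` columns at resolution 0, in the one column
      -- of their common line at resolution 1, and nowhere at resolution 2, where both digits
      -- determine the point.
      (fun i => if i = 0 then s + 1 else if i = 1 then 1 else 0) fun a b hab i hi => ?_⟩
  · obtain ⟨z, hz⟩ := exists_projForm_projForm_iff (κ.injective.ne hjk)
      (e.symm ⟨v, hv⟩) (e.symm ⟨w, hw⟩)
    refine card_filter_eq_one _ (r.symm z) fun a => ?_
    rw [r.eq_symm_apply, ← hz, e.eq_symm_apply, e.eq_symm_apply,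
      digitDesign_div_one X one_le_two, digitDesign_div_one X one_le_two, Fin.ext_iff, Fin.ext_iff]
    simp [X]
  · simp only [digitDesign_div_eq_iff X hi]
    interval_cases i
    · simp
    · obtain ⟨o, ho⟩ := exists_projForm_eq_iff (r.injective.ne hab)
      rw [card_filter_eq_one _ (κ.symm o) fun k => ?_]
      · simp
      · rw [κ.eq_symm_apply, ← ho]
        simp [X]
    · rw [Finset.card_eq_zero.2]
      · simp
      · rw [Finset.filter_eq_empty_iff]
        intro k _ h
        have h0 := h 0 two_pos
        have h1 := h 1 one_lt_two
        simp only [X, if_true, one_ne_zero, if_false, e.apply_eq_iff_eq] at h0 h1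
        obtain ⟨z, hz⟩ := exists_projForm_coForm_iff (κ k) (projForm (κ k) (r b))
          (coForm (κ k) (r b))
        exact hab (r.injective (((hz _).1 ⟨h0, h1⟩).trans ((hz _).1 ⟨rfl, rfl⟩).symm))

theorem proposition2 (s : ℕ) (hs : IsPrimePow s) :
    (∀ lam p q : ℕ, 1 ≤ lam → 1 ≤ q → q ≤ p →
      ∀ (F : Type*) [Field F] [Fintype F], Fintype.card F = s ^ p →
        (∃ H : Matrix (Fin (lam * s ^ p)) (Fin (lam * s ^ p)) F, IsGeneralizedHadamard H) →
          ∃ D : Design (lam * s ^ p) (Fin (lam * s ^ p - 1)) s q,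
            IsGSOA D (if s = 2 then 2 else 1) ∧ IsUType D ∧ AttainsLowerBounds D) ∧
    (∃ D : Design (s ^ 2) (Fin (s + 1)) s 2,
      IsGSOA D 2 ∧ IsUType D ∧ AttainsLowerBounds D) := by
  classical
  refine ⟨?_, exists_design_projective_line hs⟩
  rintro lam p q hlam hq hqp F _ _ hF ⟨H, hH⟩
  have hpos : 0 < s ^ p := pow_pos hs.pos p
  have hH' : ∀ j k, j ≠ k → ∀ g,
      (Finset.univ.filter fun i => H i j - H i k = g).card = lam := by
    intro j k hjk g
    have h := hH j k hjk g
    rw [hF, Nat.cast_mul, mul_div_assoc, div_self (by exact_mod_cast hpos.ne'), mul_one,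
      Set.ncard_eq_toFinset_card', Set.toFinset_ofPred] at h
    exact_mod_cast h
  obtain ⟨N, hN⟩ : ∃ N, lam * s ^ p = N + 1 :=
    Nat.exists_eq_succ_of_ne_zero (Nat.mul_pos hlam hpos).ne'
  clear hH
  -- The order is rewritten as `N + 1` so that column `0` can be split off.
  generalize hn : lam * s ^ p = n at H hH' hN
  subst hN
  exact exists_design_of_generalizedHadamard hs hlam hq hqp hF hn.symm H hH'
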